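/- For a field $F$ and a linear representation $\rho : G \to \mathrm{Aut}_F(V)$ of a group $G$, call the $G$-module $V$ \emph{very simple} if every $F$-subalgebra $R \subset \mathrm{End}_F(V)$ containing $\mathrm{Id}$ with $\rho(\sigma) R \rho(\sigma)^{-1} \subset R$ for all $\sigma \in G$ is either $F \cdot \mathrm{Id}$ or $\mathrm{End}_F(V)$. For a finite set $B$ with $n$ elements, let $\mathrm{Perm}(B)$ act on the space $\mathbf{F}_2^B$ of maps $h : B \to \mathbf{F}_2$ by $(sh)(b) = h(s^{-1}(b))$, let $(\mathbf{F}_2^B)^0 = \{h : \sum_{b \in B} h(b) = 0\}$, and let $1_B$ be the constant function $1$. Put $Q_B = (\mathbf{F}_2^B)^0$ if $n$ is odd and $Q_B = (\mathbf{F}_2^B)^0/(\mathbf{F}_2 \cdot 1_B)$ if $n$ is even. **Theorem.** Let $n$ be a positive integer, $B$ an $n$-element set and $G \subset \mathrm{Perm}(B)$ a permutation group. Assume that one of the following holds: (i) $n = 11$ and $G$ is isomorphic either to $\mathbf{L}_2(11) = \mathrm{PSL}_2(\mathbf{F}_{11})$ or to the Mathieu group $\mathrm{M}_{11}$; (ii)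 $n = 12$ and either $G$ is isomorphic to the Mathieu group $\mathrm{M}_{12}$, or $G$ is isomorphic to $\mathrm{M}_{11}$ and $G$ acts transitively on $B$. Then the $G$-module $Q_B$ is very simple. -/

import Mathlib

open Equiv

/-- A linear representation `ρ : G → Aut_F(V)` is very simple if every (unital) `F`-subalgebra `R`
of `End_F(V)` that is stable under conjugation by all `ρ(σ)`, `σ ∈ G`, is either `F · Id` or
`End_F(V)`. -/
def IsVerySimple {F G V : Type*} [Field F] [Group G] [AddCommGroup V] [Module F V]
    (ρ : Representation F G V) : Prop :=
  ∀ R : Subalgebra F (Module.End F V),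
    (∀ σ : G, ∀ r ∈ R, ρ σ * r * ρ σ⁻¹ ∈ R) → R = ⊥ ∨ R = ⊤

section PermutationModules

variable (F : Type*) [Field F] (B : Type*)

/-- The permutation module `F^B` of all maps `h : B → F`; a permutation `s` of `B` sends `h` to
the map `b ↦ h (s⁻¹ b)`. -/
def permRep : Representation F (Perm B) (B → F) where
  toFun s := LinearMap.funLeft F F (s⁻¹ : Perm B)
  map_one' := by ext; simp
  map_mul' s t := by ext; simp [LinearMap.funLeft]

theorem permRep_apply (s : Perm B) (h : B → F) (b : B) : permRep F B s h b = h (s⁻¹ b) := rfl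

/-- The hyperplane `(F^B)^0` of the maps `h : B → F` with `∑ h(b) = 0`. -/
def sumZero [Fintype B] : Submodule F (B → F) where
  carrier := {h | ∑ b, h b = 0}
  zero_mem' := by simp
  add_mem' {h k} hh hk := by
    simp only [Set.mem_ofPred_eq] at hh hk ⊢
    simp [Finset.sum_add_distrib, hh, hk]
  smul_mem' c h hh := by
    simp only [Set.mem_ofPred_eq] at hh ⊢
    simp [← Finset.mul_sum, hh]

theorem mem_sumZero [Fintype B] (h : B → F) : h ∈ sumZero F B ↔ ∑ b, h b = 0 := Iff.rfl

/-- The action of `Perm B` on the stable hyperplane `(F^B)^0`. -/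
def sumZeroRep [Fintype B] : Representation F (Perm B) (sumZero F B) :=
  (permRep F B).subrepresentation (sumZero F B) fun s h hh => by
    rw [Submodule.mem_comap, mem_sumZero]
    rw [mem_sumZero] at hh
    rw [← hh]
    exact Equiv.sum_comp (s⁻¹ : Perm B) h

/-- The elements of `(F^B)^0` that lie on the line `F · 1_B` spanned by the constant function `1`.
If the characteristic of `F` divides the cardinality of `B`, this is the whole line `F · 1_B`. -/
def constLine [Fintype B] : Submodule F (sumZero F B) :=
  (Submodule.span F {(1 : B → F)}).comap (sumZero F B).subtype

/-- The action of `Perm B` on the quotient `(F^B)^0 / (F · 1_B)`. -/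
def heartRep [Fintype B] : Representation F (Perm B) (sumZero F B ⧸ constLine F B) :=
  (sumZeroRep F B).quotient (constLine F B) fun s h hh => by
    obtain ⟨c, hc⟩ := Submodule.mem_span_singleton.1 (Submodule.mem_comap.1 hh)
    refine Submodule.mem_span_singleton.2 ⟨c, ?_⟩
    ext b
    exact congrFun hc ((s⁻¹ : Perm B) b)

end PermutationModules

/-- For a permutation group `G ⊆ Perm B`: the `G`-module `Q_B` is very simple. Here
`Q_B = (𝔽₂^B)^0 / (𝔽₂ · 1_B)` if the number of elements of `B` is even, and
`Q_B = (𝔽₂^B)^0` if it is odd. -/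
def QIsVerySimple {B : Type*} [Fintype B] (G : Subgroup (Perm B)) : Prop :=
  if Even (Fintype.card B) then IsVerySimple ((heartRep (ZMod 2) B).comp G.subtype)
  else IsVerySimple ((sumZeroRep (ZMod 2) B).comp G.subtype)

/-- The Mathieu group `M₁₁`, as the group of permutations of 11 letters generated by
`(1,2,3,4,5,6,7,8,9,10,11)` and `(3,7,11,8)(4,10,5,6)`
(the letters `1, …, 11` are written `0, …, 10` below). -/
def MathieuM11 : Subgroup (Perm (Fin 11)) :=
  Subgroup.closure
    {List.formPerm [0, 1, 2, 3, 4, 5, 6, 7, 8, 9, 10],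
     List.formPerm [2, 6, 10, 7] * List.formPerm [3, 9, 4, 5]}

/-- The Mathieu group `M₁₂`, as the group of permutations of 12 letters generated by
`(1,2,3,4,5,6,7,8,9,10,11)`, `(3,7,11,8)(4,10,5,6)` and `(1,12)(2,11)(3,6)(4,8)(5,9)(7,10)`
(the letters `1, …, 12` are written `0, …, 11` below). -/
def MathieuM12 : Subgroup (Perm (Fin 12)) :=
  Subgroup.closure
    {List.formPerm [0, 1, 2, 3, 4, 5, 6, 7, 8, 9, 10],
     List.formPerm [2, 6, 10, 7] * List.formPerm [3, 9, 4, 5],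
     List.formPerm [0, 11] * List.formPerm [1, 10] * List.formPerm [2, 5] *
       List.formPerm [3, 7] * List.formPerm [4, 8] * List.formPerm [6, 9]}

/-!
Let `p` be prime and let `2` be a primitive root modulo `p`. The cyclic shift `g` of `ℤ/p` acts
irreducibly on the sum-zero functions, because no proper nonzero subspace has order `≡ 1 mod p`.
If a subalgebra `R` is stable under conjugation by the group, then `g` permutes both the isotypic
components of `R` and the double annihilators of vectors in a simple `R`-submodule. Counting modulo
`p`, it fixes one of them, which is then everything: so the module is simple over `R`, or `R` is a
domain. In the first case the centralizer of `R` is a domain, and by the density theorem `R` is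
everything as soon as this centralizer consists of scalars.

It remains to exclude a stable finite field `A` larger than the field of scalars. It centralizes
`g`, so it contains the traces of the powers of `g`, which are Gaussian periods, and conjugation by
`s` permutes these: there are `0 < m < p / 2` and `c` with `(s x - s y) ^ m = c * (x - y) ^ m`.
Power sums force such an `s` to be affine, so the group has at most `p * (p - 1)` elements. For
`p = 11` the groups in question are larger than that. On `p + 1` points one restricts to the
stabilizer of a point, whose action on the heart is its action on the sum-zero functions of the
other `p` points.
-/

theorem exists_mem_eq_of_iterate_prime {α : Type*} {p : ℕ} [Fact p.Prime] {s : Set α} {f : α → α}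
    (hs : s.Finite) (hf : s.MapsTo f s) (hper : ∀ a ∈ s, f^[p] a = a) (hcard : ¬ p ∣ s.ncard) :
    ∃ a ∈ s, f a = a := by
  classical
  have := hs.fintype
  let f' : Function.End s := hf.restrict
  have hpow : f' ^ p ^ 1 = 1 := funext fun a => by
    rw [pow_one]
    change hf.restrict^[p] a = a
    rw [hf.iterate_restrict]
    exact Subtype.ext (hper a a.2)
  have hmod : s.ncard ≡ Fintype.card (Function.fixedPoints f') [MOD p] := by
    rw [← Nat.card_coe_set_eq, Nat.card_eq_fintype_card]
    exact Perm.card_fixedPoints_modEq hpow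
  obtain ⟨⟨a, ha⟩⟩ : Nonempty (Function.fixedPoints f') := by
    rw [← not_isEmpty_iff]
    intro hempty
    rw [Fintype.card_eq_zero] at hmod
    exact hcard (Nat.modEq_zero_iff_dvd.1 hmod)
  exact ⟨a, a.2, congrArg Subtype.val ha⟩

theorem not_dvd_pow_sub_one_of_lt_orderOf {p q d : ℕ} [Fact p.Prime] (hd0 : d ≠ 0)
    (hd : d < orderOf (q : ZMod p)) : ¬ p ∣ q ^ d - 1 := by
  intro h
  have hq : q ≠ 0 := by
    rintro rfl
    simp at hd
  rw [← ZMod.natCast_eq_zero_iff, Nat.cast_sub (Nat.one_le_pow _ _ (Nat.pos_of_ne_zero hq)),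
    Nat.cast_pow, Nat.cast_one, sub_eq_zero] at h
  exact pow_ne_one_of_lt_orderOf hd0 hd h

theorem orderOf_zmod_lt {p : ℕ} [Fact p.Prime] (x : ZMod p) : orderOf x < p := by
  rcases eq_or_ne x 0 with rfl | hx
  · simpa using (Fact.out : p.Prime).pos
  · exact (Nat.le_of_dvd (Nat.sub_pos_of_lt (Fact.out : p.Prime).one_lt)
      (ZMod.orderOf_dvd_card_sub_one hx)).trans_lt (Nat.sub_lt (Fact.out : p.Prime).pos one_pos)

section Irreducible

variable {F V : Type*} [Field F] [AddCommGroup V] [Module F V]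

/-- An endomorphism is irreducible if its only invariant subspaces are `0` and the whole space. -/
def IsIrreducibleEnd (f : Module.End F V) : Prop :=
  ∀ U ∈ f.invtSubmodule, U = ⊥ ∨ U = ⊤

variable [Finite V] {p : ℕ} [Fact p.Prime] {f : Module.End F V}

theorem IsIrreducibleEnd.top_mem (hirr : IsIrreducibleEnd f) (hf : f ^ p = 1)
    {S : Set (Submodule F V)} (hS : S.MapsTo (Submodule.map f) S) (hbot : ⊥ ∉ S)
    (hcard : ¬ p ∣ S.ncard) : ⊤ ∈ S := by
  have hiter (n : ℕ) (U : Submodule F V) : (Submodule.map f)^[n] U = U.map (f ^ n) := by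
    induction n with
    | zero => simp [Module.End.one_eq_id]
    | succ n ih =>
      rw [Function.iterate_succ_apply', ih, pow_succ', Module.End.mul_eq_comp, Submodule.map_comp]
  obtain ⟨U, hU, hfU⟩ := exists_mem_eq_of_iterate_prime S.toFinite hS
    (fun U _ => by rw [hiter, hf, Module.End.one_eq_id, Submodule.map_id]) hcard
  rcases hirr U ((Module.End.mem_invtSubmodule_iff_map_le _).2 hfU.le) with rfl | rfl
  · exact absurd hU hbot
  · exact hU

variable [Fintype F]

theorem not_dvd_card_submodule_sub_one
    (hq : orderOf (Fintype.card F : ZMod p) = Module.finrank F V) {U : Submodule F V}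
    (hbot : U ≠ ⊥) (htop : U ≠ ⊤) : ¬ p ∣ Nat.card U - 1 := by
  rw [Module.natCard_eq_pow_finrank (K := F), Nat.card_eq_fintype_card]
  refine not_dvd_pow_sub_one_of_lt_orderOf (mt Submodule.finrank_eq_zero.1 hbot) ?_
  rw [hq]
  exact Submodule.finrank_lt htop

theorem isIrreducibleEnd_of_pow_eq_one
    (hq : orderOf (Fintype.card F : ZMod p) = Module.finrank F V) (hf : f ^ p = 1)
    (hfix : ∀ v, f v = v → v = 0) : IsIrreducibleEnd f := by
  intro U hU
  rw [Module.End.mem_invtSubmodule_iff_forall_mem_of_mem] at hU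
  by_contra! h
  have hpred : f ^ (p - 1) * f = 1 := by
    rw [← pow_succ, Nat.sub_add_cancel (Fact.out : p.Prime).one_le, hf]
  have hmaps : ((U : Set V) \ {0}).MapsTo f (U \ {0}) := fun v hv =>
    ⟨hU v hv.1, fun (h0 : f v = 0) => hv.2 <| show v = 0 by
      rw [← Module.End.one_apply (R := F) v, ← hpred, Module.End.mul_apply, h0, map_zero]⟩
  have hper (v : V) (_ : v ∈ (U : Set V) \ {0}) : f^[p] v = v := by
    rw [← Module.End.pow_apply, hf, Module.End.one_apply]
  have hcard : ¬ p ∣ ((U : Set V) \ {0}).ncard := by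
    rw [Set.ncard_sdiff (by simp), Set.ncard_singleton, ← Nat.card_coe_set_eq]
    exact not_dvd_card_submodule_sub_one hq h.1 h.2
  obtain ⟨v, hv, hfv⟩ := exists_mem_eq_of_iterate_prime (Set.toFinite _) hmaps hper hcard
  exact hv.2 (hfix v hfv)

end Irreducible

section Semilinear

variable {R V : Type*} [Ring R] [AddCommGroup V] [Module R V] {σ σ' : R →+* R}
  [RingHomInvPair σ σ'] [RingHomInvPair σ' σ]

theorem map_isotypicComponent_le (L : V ≃ₛₗ[σ] V) (W : Submodule R V) :
    (isotypicComponent R V W).map (L : V →ₛₗ[σ] V) ≤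
      isotypicComponent R V (W.map (L : V →ₛₗ[σ] V)) := by
  rw [isotypicComponent, Submodule.map_le_iff_le_comap]
  refine sSup_le fun m ⟨φ⟩ => ?_
  rw [← Submodule.map_le_iff_le_comap]
  exact le_sSup ⟨((L.submoduleMap m).symm.trans φ).trans (L.submoduleMap W)⟩

theorem map_isotypicComponent (L : V ≃ₛₗ[σ] V) (W : Submodule R V) :
    (isotypicComponent R V W).map (L : V →ₛₗ[σ] V) =
      isotypicComponent R V (W.map (L : V →ₛₗ[σ] V)) := by
  refine le_antisymm (map_isotypicComponent_le L W) fun x hx => ?_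
  have hsymm := map_isotypicComponent_le L.symm (W.map (L : V →ₛₗ[σ] V))
  have hW : (W.map (L : V →ₛₗ[σ] V)).map (L.symm : V →ₛₗ[σ'] V) = W := by
    ext
    simp
  rw [hW] at hsymm
  exact ⟨L.symm x, hsymm ⟨x, hx, rfl⟩, by simp⟩

theorem isSimpleModule_map (L : V ≃ₛₗ[σ] V) (W : Submodule R V) [IsSimpleModule R W] :
    IsSimpleModule R (W.map (L : V →ₛₗ[σ] V)) :=
  (LinearMap.isSimpleModule_iff_of_bijective ((L.submoduleMap W : W ≃ₛₗ[σ] _) : W →ₛₗ[σ] _)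
    (L.submoduleMap W).bijective).1 inferInstance

theorem map_mem_isotypicComponents (L : V ≃ₛₗ[σ] V) {T : Submodule R V}
    (hT : T ∈ isotypicComponents R V) :
    T.map (L : V →ₛₗ[σ] V) ∈ isotypicComponents R V := by
  obtain ⟨W, hW, rfl⟩ := hT
  exact ⟨_, isSimpleModule_map L W, map_isotypicComponent L W⟩

end Semilinear

section Isotypic

variable {F R V : Type*} [Field F] [Ring R] [Algebra F R] [AddCommGroup V] [Module F V]
  [Module R V] [IsScalarTower F R V]

theorem ncard_isotypicComponents_le_finrank [FiniteDimensional F V] :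
    (isotypicComponents R V).ncard ≤ Module.finrank F V := by
  have : IsNoetherian R V := isNoetherian_of_tower F inferInstance
  let restrict := Submodule.restrictScalarsLatticeHom F R V
  let comp (T : isotypicComponents R V) : Submodule F V := restrict T
  have hcomp (T) : comp T ≠ ⊥ :=
    mt (Submodule.restrictScalars_eq_bot_iff F R V).1 (bot_lt_isotypicComponents T.2).ne'
  have hindep : iSupIndep comp := fun T => by
    simpa only [map_iSup] using
      ((sSupIndep_iff _).1 (sSupIndep_isotypicComponents R V) T).map restrict
  have := Fintype.ofFinite {T // comp T ≠ ⊥}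
  rw [← Nat.card_coe_set_eq, ← Nat.card_congr (Equiv.subtypeUnivEquiv hcomp),
    Nat.card_eq_fintype_card]
  exact hindep.subtype_ne_bot_le_finrank

variable {p : ℕ} [Fact p.Prime] {f : Module.End F V} {σ σ' : R →+* R} [RingHomInvPair σ σ']
  [RingHomInvPair σ' σ] [Finite V]

theorem IsIrreducibleEnd.isIsotypic [Nontrivial V] (hirr : IsIrreducibleEnd f) (hf : f ^ p = 1)
    (hdim : Module.finrank F V < p) (L : V ≃ₛₗ[σ] V) (hL : ∀ v, L v = f v) : IsIsotypic R V := by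
  let restrict : Submodule R V → Submodule F V := Submodule.restrictScalars F
  have hmaps : (restrict '' isotypicComponents R V).MapsTo (Submodule.map f)
      (restrict '' isotypicComponents R V) := by
    rintro _ ⟨T, hT, rfl⟩
    refine ⟨_, map_mem_isotypicComponents L hT, Submodule.ext fun v => ?_⟩
    simp only [restrict, Submodule.restrictScalars_mem, Submodule.mem_map, ← hL]
    rfl
  have hbot : ⊥ ∉ restrict '' isotypicComponents R V := by
    rintro ⟨T, hT, hT0⟩
    exact (bot_lt_isotypicComponents hT).ne' ((Submodule.restrictScalars_eq_bot_iff F R V).1 hT0)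
  have hcard : ¬ p ∣ (restrict '' isotypicComponents R V).ncard := by
    rw [Set.ncard_image_of_injective _ (Submodule.restrictScalars_injective F R V)]
    obtain ⟨W, hW⟩ := IsAtomic.exists_atom (Submodule R V)
    have hpos : 0 < (isotypicComponents R V).ncard :=
      (Set.ncard_pos).2 ⟨_, W, isSimpleModule_iff_isAtom.2 hW, rfl⟩
    exact Nat.not_dvd_of_pos_of_lt hpos
      ((ncard_isotypicComponents_le_finrank (F := F)).trans_lt hdim)
  obtain ⟨_, ⟨W, hW, rfl⟩, htop⟩ := hirr.top_mem hf hmaps hbot hcard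
  rw [Submodule.restrictScalars_eq_top_iff] at htop
  exact (IsIsotypicOfType.of_isotypicComponent_eq_top htop).isIsotypic

end Isotypic

theorem exists_end_apply_eq {R W : Type*} [Ring R] [AddCommGroup W] [Module R W]
    [IsSimpleModule R W] {w w' : W} (hw : w ≠ 0) (h : ∀ r : R, r • w = 0 → r • w' = 0) :
    ∃ φ : Module.End R W, φ w = w' := by
  let π := LinearMap.toSpanSingleton R W w
  have hπ : Function.Surjective π := IsSimpleModule.toSpanSingleton_surjective R hw
  let lift : R ⧸ LinearMap.ker π →ₗ[R] W := π.ker.liftQ (LinearMap.toSpanSingleton R W w') h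
  refine ⟨lift ∘ₗ (π.quotKerEquivOfSurjective hπ).symm, ?_⟩
  have hone : (π.quotKerEquivOfSurjective hπ).symm w = Submodule.Quotient.mk 1 := by
    rw [LinearEquiv.symm_apply_eq]
    exact (one_smul R w).symm
  rw [LinearMap.comp_apply, LinearEquiv.coe_coe, hone]
  exact one_smul R w'

section DoubleAnnihilator

variable {F R V : Type*} [Field F] [Ring R] [Algebra F R] [AddCommGroup V] [Module F V]
  [Module R V] [IsScalarTower F R V]

variable (F R) in
/-- The double annihilator of a vector `w` of an `R`-module: the vectors killed by every `r : R`
that kills `w`. It is only a subspace over the base field of `R`, since `R` need not be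
commutative. -/
def doubleAnnihilator (w : V) : Submodule F V where
  carrier := {v | ∀ r : R, r • w = 0 → r • v = 0}
  zero_mem' r _ := smul_zero r
  add_mem' ha hb r hr := by rw [smul_add, ha r hr, hb r hr, add_zero]
  smul_mem' a v hv r hr := by
    rw [← algebraMap_smul R a v, ← mul_smul, ← Algebra.commutes, mul_smul, hv r hr, smul_zero]

theorem mem_doubleAnnihilator {w v : V} :
    v ∈ doubleAnnihilator F R w ↔ ∀ r : R, r • w = 0 → r • v = 0 := Iff.rfl

theorem self_mem_doubleAnnihilator (w : V) : w ∈ doubleAnnihilator F R w := fun _ => id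

theorem map_doubleAnnihilator {σ σ' : R →+* R} [RingHomInvPair σ σ'] [RingHomInvPair σ' σ]
    (L : V ≃ₛₗ[σ] V) {f : Module.End F V} (hL : ∀ v, L v = f v) (w : V) :
    (doubleAnnihilator F R w).map f = doubleAnnihilator F R (f w) := by
  have hσ (r : R) (v : V) : r • f v = f (σ' r • v) := by
    rw [← hL, ← hL, map_smulₛₗ, RingHomInvPair.comp_apply_eq₂]
  have hinj : Function.Injective f := (funext hL : ⇑L = f) ▸ L.injective
  ext v
  rw [Submodule.mem_map]
  constructor
  · rintro ⟨u, hu, rfl⟩ r hr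
    rw [hσ, map_eq_zero_iff f hinj] at hr ⊢
    exact hu _ hr
  · intro hv
    refine ⟨L.symm v, fun r hr => hinj ?_, by rw [← hL, L.apply_symm_apply]⟩
    have := hv (σ r) (by rw [hσ, RingHomInvPair.comp_apply_eq, hr, map_zero])
    rwa [map_zero, ← hL, map_smulₛₗ, L.apply_symm_apply]

theorem doubleAnnihilator_eq_of_injective {W : Type*} [AddCommGroup W] [Module R W]
    {φ ψ : W →ₗ[R] V} (hφ : Function.Injective φ) (hψ : Function.Injective ψ) (w : W) :
    doubleAnnihilator F R (φ w) = doubleAnnihilator F R (ψ w) := by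
  ext v
  simp only [mem_doubleAnnihilator, ← map_smul, map_eq_zero_iff φ hφ, map_eq_zero_iff ψ hψ]

theorem isDomain_of_doubleAnnihilator_eq_top [FaithfulSMul R V] {W : Submodule R V}
    [IsSimpleModule R W] {w : V} (hw : w ∈ W) (hw0 : w ≠ 0)
    (h : doubleAnnihilator F R w = ⊤) : IsDomain R := by
  have hann (r : R) (hr : r • w = 0) : r = 0 := by
    refine FaithfulSMul.eq_of_smul_eq_smul fun v : V => ?_
    rw [zero_smul]
    exact mem_doubleAnnihilator.1 (h ▸ Submodule.mem_top) r hr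
  have hinv (r : R) (hr : r ≠ 0) : ∃ s, s * r = 1 := by
    have hrw : (⟨r • w, W.smul_mem r hw⟩ : W) ≠ 0 := fun h0 =>
      hr (hann r (congrArg Subtype.val h0))
    obtain ⟨s, hs⟩ := IsSimpleModule.toSpanSingleton_surjective R hrw ⟨w, hw⟩
    refine ⟨s, sub_eq_zero.1 (hann _ ?_)⟩
    rw [sub_smul, mul_smul, one_smul, sub_eq_zero]
    exact congrArg Subtype.val hs
  have : Nontrivial R := ⟨1, 0, fun h0 => hw0 (by rw [← one_smul R w, h0, zero_smul])⟩
  have : NoZeroDivisors R := ⟨fun {r t} hrt => or_iff_not_imp_left.2 fun hr => by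
    obtain ⟨s, hs⟩ := hinv r hr
    rw [← one_mul t, ← hs, mul_assoc, hrt, mul_zero]⟩
  exact NoZeroDivisors.to_isDomain R

-- Two nonzero vectors of `W` have the same double annihilator if and only if they span the same
-- line over the division ring `End_R(W)`, so the double annihilators form a projective space.
variable (F) in
theorem ncard_doubleAnnihilator_mul (W : Submodule R V) [IsSimpleModule R W] :
    (doubleAnnihilator F R '' (W \ {0} : Set V)).ncard * (Nat.card (Module.End R W) - 1) =
      Nat.card W - 1 := by
  classical
  let E : Projectivization (Module.End R W) W → Submodule F V :=
    Projectivization.lift (fun w => doubleAnnihilator F R (w.1 : V)) fun u w φ h => by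
      have hφ : φ ≠ 0 := fun h0 => u.2 (by rw [h, h0, zero_smul])
      change doubleAnnihilator F R (W.subtype u) = doubleAnnihilator F R (W.subtype w)
      rw [h]
      exact doubleAnnihilator_eq_of_injective (φ := W.subtype ∘ₗ φ)
        (W.subtype_injective.comp (LinearMap.injective_of_ne_zero hφ)) W.subtype_injective _
  have hE : Function.Injective E := by
    intro P Q
    induction P with | h u hu
    induction Q with | h w hw
    intro (h : doubleAnnihilator F R (u : V) = doubleAnnihilator F R (w : V))
    have hmem : (u : V) ∈ doubleAnnihilator F R (w : V) := h ▸ self_mem_doubleAnnihilator _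
    rw [Projectivization.mk_eq_mk_iff']
    exact exists_end_apply_eq hw fun r hr => Subtype.ext (hmem r (congrArg Subtype.val hr))
  have himage : doubleAnnihilator F R '' (W \ {0} : Set V) = Set.range E := by
    ext U
    constructor
    · rintro ⟨w, ⟨hw, hw0⟩, rfl⟩
      exact ⟨.mk _ ⟨w, hw⟩ fun h => hw0 (congrArg Subtype.val h), rfl⟩
    · rintro ⟨P, rfl⟩
      induction P with | h w hw
      exact ⟨w, ⟨w.2, fun h => hw (Subtype.ext h)⟩, rfl⟩
  rw [himage, ← Nat.card_coe_set_eq, ← Nat.card_congr (Equiv.ofInjective E hE),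
    Projectivization.card (Module.End R W) W]

variable [Finite V] {p : ℕ} [Fact p.Prime] {f : Module.End F V} {σ σ' : R →+* R}
  [RingHomInvPair σ σ'] [RingHomInvPair σ' σ]

theorem IsIrreducibleEnd.isDomain [FaithfulSMul R V] (hirr : IsIrreducibleEnd f) (hf : f ^ p = 1)
    (L : V ≃ₛₗ[σ] V) (hL : ∀ v, L v = f v) (hiso : IsIsotypic R V) {W : Submodule R V}
    [IsSimpleModule R W] (hW : ¬ p ∣ Nat.card W - 1) : IsDomain R := by
  have hmaps : (doubleAnnihilator F R '' (W \ {0} : Set V)).MapsTo (Submodule.map f)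
      (doubleAnnihilator F R '' (W \ {0} : Set V)) := by
    rintro _ ⟨w, ⟨hw, hw0⟩, rfl⟩
    have := isSimpleModule_map L W
    obtain ⟨ψ⟩ := hiso W (W.map (L : V →ₛₗ[σ] V))
    let w' : W.map (L : V →ₛₗ[σ] V) := ⟨f w, w, hw, hL w⟩
    have hw' : w' ≠ 0 := fun h => hw0 <| L.injective <| by
      rw [hL, map_zero]
      exact congrArg Subtype.val h
    refine ⟨ψ w', ⟨(ψ w').2, by simpa using hw'⟩, ?_⟩
    rw [map_doubleAnnihilator L hL]
    exact doubleAnnihilator_eq_of_injective (φ := W.subtype ∘ₗ ψ.toLinearMap)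
      (ψ := (W.map (L : V →ₛₗ[σ] V)).subtype) (W.subtype_injective.comp ψ.injective)
      (Submodule.subtype_injective _) w'
  have hbot : ⊥ ∉ doubleAnnihilator F R '' (W \ {0} : Set V) := by
    rintro ⟨w, ⟨-, hw0⟩, h⟩
    exact hw0 ((Submodule.mem_bot F).1 (h ▸ self_mem_doubleAnnihilator w))
  have hcard : ¬ p ∣ (doubleAnnihilator F R '' (W \ {0} : Set V)).ncard := fun h =>
    hW (ncard_doubleAnnihilator_mul F W ▸ h.mul_right _)
  obtain ⟨w, ⟨hw, hw0⟩, htop⟩ := hirr.top_mem hf hmaps hbot hcard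
  exact isDomain_of_doubleAnnihilator_eq_top hw hw0 htop

theorem IsIrreducibleEnd.isSimpleModule_or_isDomain [Fintype F] [Nontrivial V] [FaithfulSMul R V]
    (hirr : IsIrreducibleEnd f) (hf : f ^ p = 1)
    (hq : orderOf (Fintype.card F : ZMod p) = Module.finrank F V)
    (L : V ≃ₛₗ[σ] V) (hL : ∀ v, L v = f v) : IsSimpleModule R V ∨ IsDomain R := by
  have hiso : IsIsotypic R V := hirr.isIsotypic hf (hq ▸ orderOf_zmod_lt _) L hL
  obtain ⟨W, hW⟩ := IsAtomic.exists_atom (Submodule R V)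
  rw [← isSimpleModule_iff_isAtom] at hW
  rcases eq_or_ne W ⊤ with rfl | htop
  · exact .inl (IsSimpleModule.congr (N := (⊤ : Submodule R V)) Submodule.topEquiv.symm)
  · refine .inr (hirr.isDomain hf L hL hiso (W := W) ?_)
    refine not_dvd_card_submodule_sub_one (U := W.restrictScalars F) hq ?_ ?_
    · exact mt (Submodule.restrictScalars_eq_bot_iff F R V).1 (isSimpleModule_iff_isAtom.1 hW).1
    · exact mt (Submodule.restrictScalars_eq_top_iff F R V).1 htop

end DoubleAnnihilator

section Conjugation

variable {F V G : Type*} [Field F] [AddCommGroup V] [Module F V] [Group G]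
  {ρ : Representation F G V} {R : Subalgebra F (Module.End F V)}

/-- A subalgebra of `End_F(V)` is stable under conjugation by the operators of a representation:
this is the condition imposed on subalgebras in the definition of a very simple module. -/
def IsConjStable (ρ : Representation F G V) (R : Subalgebra F (Module.End F V)) : Prop :=
  ∀ σ : G, ∀ r ∈ R, ρ σ * r * ρ σ⁻¹ ∈ R

namespace IsConjStable

theorem centralizer (hR : IsConjStable ρ R) :
    IsConjStable ρ (Subalgebra.centralizer F (R : Set (Module.End F V))) := by
  intro σ a ha
  rw [Subalgebra.mem_centralizer_iff] at ha ⊢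
  intro r hr
  have hcomm : ρ σ⁻¹ * r * ρ σ * a = a * (ρ σ⁻¹ * r * ρ σ) := by
    simpa only [inv_inv] using ha _ (hR σ⁻¹ r hr)
  have hinv : ρ σ * ρ σ⁻¹ = 1 := by rw [← map_mul, mul_inv_cancel, map_one]
  calc r * (ρ σ * a * ρ σ⁻¹) = ρ σ * (ρ σ⁻¹ * r * ρ σ * a) * ρ σ⁻¹ := by
        simp only [← mul_assoc, hinv, one_mul]
    _ = ρ σ * a * ρ σ⁻¹ * r := by
        rw [hcomm]
        simp only [mul_assoc, hinv, mul_one]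

/-- The action of `G` on a stable subalgebra by conjugation. -/
def conjAut (hR : IsConjStable ρ R) : G →* (R ≃ₐ[F] R) :=
  let conj : G →* (Module.End F V ≃ₐ[F] Module.End F V) :=
    (MulSemiringAction.toAlgAut (ConjAct (Module.End F V)ˣ) F (Module.End F V)).comp
      (ConjAct.toConjAct.toMonoidHom.comp ρ.asGroupHom)
  let restrict : G →* (R →ₐ[F] R) :=
    { toFun σ := ((conj σ).toAlgHom.comp R.val).codRestrict R fun r => hR σ r r.2
      map_one' := by
        ext1 r
        exact Subtype.ext (DFunLike.congr_fun (map_one conj) (r : Module.End F V))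
      map_mul' σ τ := by
        ext1 r
        exact Subtype.ext (DFunLike.congr_fun (map_mul conj σ τ) (r : Module.End F V)) }
  (AlgEquiv.algHomUnitsEquiv F R).toMonoidHom.comp restrict.toHomUnits

theorem coe_conjAut (hR : IsConjStable ρ R) (σ : G) (r : R) :
    (hR.conjAut σ r : Module.End F V) = ρ σ * r * ρ σ⁻¹ := rfl

end IsConjStable

end Conjugation

section Density

variable {F V : Type*} [Field F] [AddCommGroup V] [Module F V] {R : Subalgebra F (Module.End F V)}

theorem isDomain_centralizer [IsSimpleModule R V] :
    IsDomain (Subalgebra.centralizer F (R : Set (Module.End F V))) := by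
  classical
  let toEnd : Subalgebra.centralizer F (R : Set (Module.End F V)) →+* Module.End R V :=
    { toFun a :=
        { toFun := a.1
          map_add' := map_add a.1
          map_smul' r v :=
            (LinearMap.congr_fun ((Subalgebra.mem_centralizer_iff F).1 a.2 r r.2) v).symm }
      map_one' := rfl
      map_mul' _ _ := rfl
      map_zero' := rfl
      map_add' _ _ := rfl }
  have : IsDomain (Module.End R V) := DivisionRing.isDomain (K := Module.End R V)
  exact Function.Injective.isDomain toEnd fun a b h =>
    Subtype.ext (LinearMap.ext fun v => LinearMap.congr_fun h v)

theorem eq_top_of_centralizer_eq_bot [FiniteDimensional F V] [IsSimpleModule R V]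
    (h : Subalgebra.centralizer F (R : Set (Module.End F V)) = ⊥) : R = ⊤ := by
  classical
  rw [eq_top_iff]
  intro f _
  have hscalar (a : Module.End R V) : ∃ c : F, ∀ v, a v = c • v := by
    have ha : a.restrictScalars F ∈ Subalgebra.centralizer F (R : Set (Module.End F V)) :=
      (Subalgebra.mem_centralizer_iff F).2 fun r hr =>
        LinearMap.ext fun v => (a.map_smul ⟨r, hr⟩ v).symm
    rw [h, Algebra.mem_bot] at ha
    obtain ⟨c, hc⟩ := ha
    exact ⟨c, fun v => (LinearMap.congr_fun hc v).symm⟩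
  let f' : Module.End (Module.End R V) V :=
    { toFun := f
      map_add' := map_add f
      map_smul' a v := by
        obtain ⟨c, hc⟩ := hscalar a
        simp only [Module.End.smul_def, hc, map_smul, RingHom.id_apply] }
  let b := Module.finBasis F V
  obtain ⟨r, hr⟩ := jacobson_density (R := R) f' (Finset.univ.image b)
  have hfr : f = r := b.ext fun i => hr (b i) (Finset.mem_image_of_mem b (Finset.mem_univ i))
  exact hfr ▸ r.2

end Density

theorem isVerySimple_of_forall_isDomain {F V G : Type*} [Field F] [Fintype F] [AddCommGroup V]
    [Module F V] [Finite V] [Nontrivial V] [Group G] {ρ : Representation F G V} {p : ℕ}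
    [Fact p.Prime] (hq : orderOf (Fintype.card F : ZMod p) = Module.finrank F V) {g : G}
    (hg : g ^ p = 1) (hirr : IsIrreducibleEnd (ρ g))
    (hdom : ∀ A : Subalgebra F (Module.End F V), IsConjStable ρ A → IsDomain A → A = ⊥) :
    IsVerySimple ρ := by
  intro R (hR : IsConjStable ρ R)
  let e : R ≃+* R := (hR.conjAut g).toRingEquiv
  let := RingHomInvPair.of_ringEquiv e
  let := RingHomInvPair.symm (e : R →+* R) (e.symm : R →+* R)
  let L : V ≃ₛₗ[(e : R →+* R)] V :=
    { toFun := ρ g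
      invFun := ρ g⁻¹
      map_add' := map_add _
      map_smul' r v := by
        change ρ g (r.1 v) = ρ g (r.1 (ρ g⁻¹ (ρ g v)))
        rw [ρ.inv_self_apply]
      left_inv := ρ.inv_self_apply g
      right_inv := ρ.self_inv_apply g }
  have hgp : ρ g ^ p = 1 := by rw [← map_pow, hg, map_one]
  rcases hirr.isSimpleModule_or_isDomain hgp hq L (fun _ => rfl) with hsimple | hR'
  · exact .inr (eq_top_of_centralizer_eq_bot (hdom _ hR.centralizer isDomain_centralizer))
  · exact .inl (hdom R hR hR')

section FiniteDomain

variable {F : Type*} [Field F]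

theorem finrank_dvd_finrank_of_isDomain {A V : Type*} [Ring A] [Algebra F A] [Finite A]
    [IsDomain A] [AddCommGroup V] [Module F V] [Module A V] [IsScalarTower F A V] :
    Module.finrank F A ∣ Module.finrank F V := by
  let := (Finite.isDomain_to_isField A).toField
  exact ⟨_, (Module.finrank_mul_finrank F A V).symm⟩

theorem algEquiv_eq_one_of_pow_eq_one {A : Type*} [Ring A] [Algebra F A] [Finite A] [IsDomain A]
    {τ : A ≃ₐ[F] A} {k : ℕ} (hk : k.Coprime (Module.finrank F A)) (hτ : τ ^ k = 1) : τ = 1 := by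
  obtain ⟨K, rfl⟩ : ∃ K : Field A, K.toRing = ‹Ring A› :=
    ⟨(Finite.isDomain_to_isField A).toField, rfl⟩
  have : Finite F := .of_injective _ (algebraMap F A).injective
  rw [← orderOf_eq_one_iff]
  refine Nat.eq_one_of_dvd_coprimes hk (orderOf_dvd_of_pow_eq_one hτ) ?_
  rw [← IsGalois.card_aut_eq_finrank F A]
  exact orderOf_dvd_natCard τ

theorem exists_forall_sum_pow_card_mem_range {A C : Type*} [Ring A] [Algebra F A] [Finite A]
    [IsDomain A] [Ring C] [Algebra F C] [Finite C] [IsDomain C] (φ : A →ₐ[F] C) :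
    ∃ m, Module.finrank F A * m = Module.finrank F C ∧ ∀ τ : A ≃ₐ[F] A, ∃ j, ∀ x : C, ∃ a : A,
      φ a = ∑ i ∈ Finset.range m, x ^ Nat.card A ^ i ∧
      φ (τ a) = ∑ i ∈ Finset.range m, x ^ (Nat.card A ^ i * Nat.card F ^ j) := by
  obtain ⟨K, rfl⟩ : ∃ K : Field A, K.toRing = ‹Ring A› :=
    ⟨(Finite.isDomain_to_isField A).toField, rfl⟩
  obtain ⟨L, rfl⟩ : ∃ L : Field C, L.toRing = ‹Ring C› :=
    ⟨(Finite.isDomain_to_isField C).toField, rfl⟩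
  let := φ.toRingHom.toAlgebra
  have : IsScalarTower F A C := .of_algHom φ
  refine ⟨Module.finrank A C, Module.finrank_mul_finrank F A C, fun τ => ?_⟩
  have : Finite F := .of_injective _ (algebraMap F A).injective
  have := Fintype.ofFinite F
  obtain ⟨r, _, n, hr, hcard⟩ := FiniteField.card' F
  have := Fact.mk hr
  have : CharP C r := charP_of_injective_algebraMap (algebraMap F C).injective r
  obtain ⟨j, hj⟩ := FiniteField.exists_forall_apply_eq_pow F r A τ
  have htrace (x : C) := FiniteField.algebraMap_trace_eq_sum_pow A C x
  refine ⟨j, fun x => ⟨Algebra.trace A C x, htrace x, ?_⟩⟩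
  calc φ (τ (Algebra.trace A C x)) = algebraMap A C (Algebra.trace A C x) ^ Nat.card F ^ j := by
        rw [hj, map_pow]
        rfl
    _ = ∑ i ∈ Finset.range (Module.finrank A C), x ^ (Nat.card A ^ i * Nat.card F ^ j) := by
        simp only [htrace, Nat.card_eq_fintype_card (α := F), hcard, ← pow_mul, sum_pow_char_pow]

end FiniteDomain

section StableDomain

variable {F V G : Type*} [Field F] [AddCommGroup V] [Module F V] [Group G]
  {ρ : Representation F G V} {A : Subalgebra F (Module.End F V)}

theorem IsIrreducibleEnd.isDomain_centralizer [Nontrivial V] {f : Module.End F V}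
    (hf : IsIrreducibleEnd f) :
    IsDomain (Subalgebra.centralizer F ({f} : Set (Module.End F V))) := by
  have hinj (c : Subalgebra.centralizer F ({f} : Set (Module.End F V))) (hc : c ≠ 0) :
      LinearMap.ker c.1 = ⊥ := by
    refine (hf (LinearMap.ker c.1) fun v hv => ?_).resolve_right fun htop =>
      hc (Subtype.ext (LinearMap.ker_eq_top.1 htop))
    have hcomm := LinearMap.congr_fun ((Subalgebra.mem_centralizer_iff F).1 c.2 f rfl) v
    rw [Submodule.mem_comap, LinearMap.mem_ker]
    rw [LinearMap.mem_ker] at hv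
    rw [Module.End.mul_apply, Module.End.mul_apply, hv, map_zero] at hcomm
    exact hcomm.symm
  have : NoZeroDivisors (Subalgebra.centralizer F ({f} : Set (Module.End F V))) :=
    ⟨fun {c d} hcd => or_iff_not_imp_left.2 fun hc => Subtype.ext <| LinearMap.ext fun v =>
      LinearMap.ker_eq_bot.1 (hinj c hc) <| by
        rw [ZeroMemClass.coe_zero, LinearMap.zero_apply, map_zero]
        exact LinearMap.congr_fun (congrArg Subtype.val hcd) v⟩
  exact NoZeroDivisors.to_isDomain _

variable [Finite V] [IsDomain A] {p : ℕ} {g : G}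

theorem IsConjStable.le_centralizer (hA : IsConjStable ρ A)
    (hp : p.Coprime (Module.finrank F V)) (hg : g ^ p = 1) :
    A ≤ Subalgebra.centralizer F ({ρ g} : Set (Module.End F V)) := by
  have : Finite (Module.End F V) := DFunLike.finite _
  have htriv : hA.conjAut g = 1 :=
    algEquiv_eq_one_of_pow_eq_one (hp.of_dvd_right finrank_dvd_finrank_of_isDomain)
      (by rw [← map_pow, hg, map_one])
  intro a ha
  rw [Subalgebra.mem_centralizer_iff]
  rintro _ rfl
  have := congrArg Subtype.val (DFunLike.congr_fun htriv (⟨a, ha⟩ : A))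
  rw [hA.coe_conjAut] at this
  calc ρ g * a = ρ g * a * ρ g⁻¹ * ρ g := by
        rw [mul_assoc _ (ρ g⁻¹), ← map_mul, inv_mul_cancel, map_one, mul_one]
    _ = a * ρ g := by rw [this]; rfl

theorem IsConjStable.exists_conj_sum_pow [Nontrivial V] (hA : IsConjStable ρ A) (hbot : A ≠ ⊥)
    (hp : p.Coprime (Module.finrank F V)) (hg : g ^ p = 1) (hirr : IsIrreducibleEnd (ρ g)) :
    ∃ n m, n ≠ 1 ∧ n * m ∣ Module.finrank F V ∧ ∀ σ : G, ∃ j, ∀ k : ℕ,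
      ρ σ * (∑ i ∈ Finset.range m, ρ g ^ (k * Nat.card F ^ (n * i))) * ρ σ⁻¹ =
        ∑ i ∈ Finset.range m, ρ g ^ (k * (Nat.card F ^ (n * i) * Nat.card F ^ j)) := by
  have : Finite (Module.End F V) := DFunLike.finite _
  let C := Subalgebra.centralizer F ({ρ g} : Set (Module.End F V))
  have : IsDomain C := hirr.isDomain_centralizer
  let x : C := ⟨ρ g, (Subalgebra.mem_centralizer_iff F).2 fun _ h => by rw [h]⟩
  obtain ⟨m, hm, hsum⟩ :=
    exists_forall_sum_pow_card_mem_range (Subalgebra.inclusion (hA.le_centralizer hp hg))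
  have hcard (i : ℕ) : Nat.card F ^ (Module.finrank F A * i) = Nat.card A ^ i := by
    rw [Module.natCard_eq_pow_finrank (K := F) (V := A), pow_mul]
  refine ⟨Module.finrank F A, m, fun h => hbot (Subalgebra.eq_bot_of_finrank_one h),
    hm ▸ finrank_dvd_finrank_of_isDomain (A := C), fun σ => ?_⟩
  obtain ⟨j, hj⟩ := hsum (hA.conjAut σ)
  refine ⟨j, fun k => ?_⟩
  obtain ⟨a, ha, hτa⟩ := hj (x ^ k)
  simp only [← pow_mul, ← hcard] at ha hτa
  calc _ = ρ σ * a * ρ σ⁻¹ := by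
        congr 2
        simpa [x] using (congrArg Subtype.val ha).symm
    _ = _ := by
        rw [← hA.coe_conjAut]
        simpa [x] using congrArg Subtype.val hτa

end StableDomain

section PermutationOperators

variable {F B : Type*} [Field F]

theorem permRep_single [DecidableEq B] (s : Perm B) (b : B) :
    permRep F B s (Pi.single b 1) = Pi.single (s b) 1 := by
  ext x
  rw [permRep_apply, Pi.single_apply, Pi.single_apply]
  congr 1
  rw [Perm.inv_eq_iff_eq]

variable [Fintype B]

theorem finrank_sumZero [Nonempty B] : Module.finrank F (sumZero F B) = Fintype.card B - 1 := by
  classical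
  let sum : Module.Dual F (B → F) := ∑ b, LinearMap.proj b
  have hsum (h : B → F) : sum h = ∑ b, h b := by simp [sum]
  have hker : LinearMap.ker sum = sumZero F B := by
    ext h
    rw [LinearMap.mem_ker, hsum, mem_sumZero]
  have hsum0 : sum ≠ 0 := fun h0 => by
    have := LinearMap.congr_fun h0 (Pi.single (Classical.arbitrary B) 1)
    simp [hsum] at this
  have := Module.Dual.finrank_ker_add_one_of_ne_zero hsum0
  rw [hker, Module.finrank_fintype_fun_eq_card] at this
  exact Nat.eq_sub_of_add_eq this

theorem sum_permRep_eq_of_sum_sumZeroRep_eq {ι : Type*} (hB : (Fintype.card B : F) ≠ 0)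
    {I : Finset ι} {u w : ι → Perm B}
    (h : ∑ i ∈ I, sumZeroRep F B (u i) = ∑ i ∈ I, sumZeroRep F B (w i)) :
    ∑ i ∈ I, permRep F B (u i) = ∑ i ∈ I, permRep F B (w i) := by
  have hsumZero (f : B → F) (hf : f ∈ sumZero F B) :
      (∑ i ∈ I, permRep F B (u i)) f = (∑ i ∈ I, permRep F B (w i)) f := by
    have := congrArg Subtype.val (LinearMap.congr_fun h ⟨f, hf⟩)
    simp only [LinearMap.sum_apply, Submodule.coe_sum] at this ⊢
    exact this
  have hone : (∑ i ∈ I, permRep F B (u i)) 1 = (∑ i ∈ I, permRep F B (w i)) 1 := by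
    simp only [LinearMap.sum_apply]
    rfl
  ext1 f
  let c := (∑ b, f b) / Fintype.card B
  have hc : f - c • 1 ∈ sumZero F B := by
    simp [mem_sumZero, c, mul_div_cancel₀ _ hB]
  have := hsumZero _ hc
  rwa [map_sub, map_sub, map_smul, map_smul, hone, sub_left_inj] at this

theorem exists_apply_eq_of_sum_sumZeroRep_eq {ι : Type*} (hB : (Fintype.card B : F) ≠ 0)
    {I : Finset ι} {u w : ι → Perm B}
    (h : ∑ i ∈ I, sumZeroRep F B (u i) = ∑ i ∈ I, sumZeroRep F B (w i)) {b : B}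
    (hu : Set.InjOn (u · b) I) {i : ι} (hi : i ∈ I) : ∃ k ∈ I, w k b = u i b := by
  classical
  by_contra! hne
  have := congrFun (LinearMap.congr_fun (sum_permRep_eq_of_sum_sumZeroRep_eq hB h)
    (Pi.single b 1)) (u i b)
  simp only [LinearMap.sum_apply, permRep_single, Finset.sum_apply] at this
  rw [Finset.sum_eq_single_of_mem i hi, Pi.single_eq_same, Finset.sum_eq_zero] at this
  · exact one_ne_zero this
  · exact fun k hk => Pi.single_eq_of_ne (hne k hk).symm _
  · exact fun k hk hki => Pi.single_eq_of_ne (fun heq => hki (hu hk hi heq.symm)) _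

end PermutationOperators

section Shift

variable {p : ℕ} [Fact p.Prime]

variable (p) in
/-- The cyclic shift `x ↦ x + 1` of `ℤ/p`. -/
def shift : Perm (ZMod p) := Equiv.addRight 1

theorem shift_pow_apply (n : ℕ) (x : ZMod p) : (shift p ^ n) x = x + n := by
  rw [shift, Equiv.nsmul_addRight, Equiv.coe_addRight, nsmul_one]

theorem shift_pow_self : shift p ^ p = 1 := by
  ext1 x
  rw [shift_pow_apply, CharP.cast_eq_zero, add_zero, Perm.one_apply]

variable {F : Type*} [Field F]

theorem eq_zero_of_sumZeroRep_shift_eq (hp : (p : F) ≠ 0) {v : sumZero F (ZMod p)}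
    (hv : sumZeroRep F (ZMod p) (shift p) v = v) : v = 0 := by
  have hper : Function.Periodic v.1 1 := fun x => by
    have : v.1 ((shift p)⁻¹ (x + 1)) = v.1 (x + 1) := congrFun (congrArg Subtype.val hv) (x + 1)
    rwa [Perm.inv_eq_iff_eq.2 (show x + 1 = shift p x from rfl), eq_comm] at this
  have hconst (x : ZMod p) : v.1 x = v.1 0 := by
    simpa using hper.nat_mul_eq x.val
  have hsum : ∑ x, v.1 x = 0 := v.2
  simp only [hconst, Finset.sum_const, Finset.card_univ, ZMod.card, nsmul_eq_mul,
    mul_eq_zero, hp, false_or] at hsum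
  exact Subtype.ext (funext fun x => (hconst x).trans hsum)

theorem exists_apply_add_eq {ι : Type*} (hp : (p : F) ≠ 0) {s : Perm (ZMod p)} {I : Finset ι}
    {a c : ι → ℕ} (h : sumZeroRep F (ZMod p) s *
      (∑ i ∈ I, sumZeroRep F (ZMod p) (shift p) ^ a i) * sumZeroRep F (ZMod p) s⁻¹ =
        ∑ i ∈ I, sumZeroRep F (ZMod p) (shift p) ^ c i)
    (ha : Set.InjOn (fun i => (a i : ZMod p)) I) (x : ZMod p) {i : ι} (hi : i ∈ I) :
    ∃ k ∈ I, s (x + a i) = s x + c k := by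
  have hconj (i : ι) : (s * shift p ^ a i * s⁻¹) (s x) = s (x + a i) := by
    rw [Perm.mul_apply, Perm.mul_apply, Perm.inv_def, symm_apply_apply, shift_pow_apply]
  simp only [Finset.mul_sum, Finset.sum_mul, ← map_pow, ← map_mul] at h
  obtain ⟨k, hk, heq⟩ := exists_apply_eq_of_sum_sumZeroRep_eq (by rwa [ZMod.card]) h (b := s x)
    (fun i hi i' hi' hii' => ha hi hi' (by simpa only [hconj, s.injective.eq_iff,
      add_right_inj] using hii')) hi
  exact ⟨k, hk, by rw [← hconj, ← heq, shift_pow_apply]⟩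

variable [Fintype F]

theorem natCast_ne_zero_of_orderOf_card (hq : orderOf (Fintype.card F : ZMod p) = p - 1) :
    (p : F) ≠ 0 := by
  intro hp
  obtain ⟨r, _, n, hr, hcard⟩ := FiniteField.card' F
  have hpr : p = r := ((Nat.prime_dvd_prime_iff_eq hr Fact.out).1
    ((CharP.cast_eq_zero_iff F r p).1 hp)).symm
  rw [hcard, ← hpr, Nat.cast_pow, CharP.cast_eq_zero, zero_pow n.ne_zero, orderOf_zero] at hq
  exact (Nat.sub_pos_of_lt (Fact.out : p.Prime).one_lt).ne hq

theorem isIrreducibleEnd_sumZeroRep_shift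
    (hq : orderOf (Fintype.card F : ZMod p) = p - 1) :
    IsIrreducibleEnd (sumZeroRep F (ZMod p) (shift p)) := by
  refine isIrreducibleEnd_of_pow_eq_one (p := p) ?_ ?_ fun v =>
    eq_zero_of_sumZeroRep_shift_eq (natCast_ne_zero_of_orderOf_card hq)
  · rw [hq, finrank_sumZero, ZMod.card]
  · rw [← map_pow, shift_pow_self, map_one]

-- Conjugation by `s` sends a Gaussian period of the shift to another one.
theorem exists_sub_eq_mul_pow (hq : orderOf (Fintype.card F : ZMod p) = p - 1)
    {H : Subgroup (Perm (ZMod p))} (hH : shift p ∈ H)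
    {A : Subalgebra F (Module.End F (sumZero F (ZMod p)))} [IsDomain A]
    (hA : IsConjStable ((sumZeroRep F (ZMod p)).comp H.subtype) A) (hbot : A ≠ ⊥) :
    ∃ n, n ≠ 1 ∧ n ∣ p - 1 ∧ ∀ s ∈ H, ∃ j, ∀ x y, ∃ i,
      s x - s y = (x - y) * ((Fintype.card F : ZMod p) ^ (n * i) * Fintype.card F ^ j) := by
  have hdim : Module.finrank F (sumZero F (ZMod p)) = p - 1 := by rw [finrank_sumZero, ZMod.card]
  have hpos : 0 < p - 1 := Nat.sub_pos_of_lt (Fact.out : p.Prime).one_lt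
  have : Nontrivial (sumZero F (ZMod p)) := Module.nontrivial_of_finrank_pos (hdim ▸ hpos)
  have hcop : p.Coprime (Module.finrank F (sumZero F (ZMod p))) := by
    rw [hdim]
    exact (Nat.coprime_of_lt_prime hpos.ne' (Nat.sub_lt (Fact.out : p.Prime).pos one_pos)
      Fact.out)
  have hpow : (⟨shift p, hH⟩ : H) ^ p = 1 := Subtype.ext shift_pow_self
  obtain ⟨n, m, hn1, hm, hconj⟩ :=
    hA.exists_conj_sum_pow hbot hcop hpow (isIrreducibleEnd_sumZeroRep_shift hq)
  rw [hdim] at hm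
  have hm0 : 0 < m := Nat.pos_of_mul_pos_left (Nat.pos_of_dvd_of_pos hm hpos)
  have hn0 : 0 < n := Nat.pos_of_mul_pos_right (Nat.pos_of_dvd_of_pos hm hpos)
  refine ⟨n, hn1, (Dvd.intro m rfl).trans hm, fun s hs => ?_⟩
  obtain ⟨j, hj⟩ := hconj ⟨s, hs⟩
  simp only [Nat.card_eq_fintype_card (α := F)] at hj
  refine ⟨j, fun x y => ?_⟩
  rcases eq_or_ne x y with rfl | hxy
  · exact ⟨0, by rw [sub_self, sub_self, zero_mul]⟩
  have hlt {i : ℕ} (hi : i ∈ Finset.range m) :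
      n * i < orderOf (Fintype.card F : ZMod p) :=
    hq ▸ (Nat.mul_lt_mul_of_pos_left (Finset.mem_range.1 hi) hn0).trans_le (Nat.le_of_dvd hpos hm)
  have hinj : Set.InjOn (fun i => (((x - y).val * Fintype.card F ^ (n * i) : ℕ) : ZMod p))
      (Finset.range m) := by
    intro i hi i' hi' heq
    simp only [Nat.cast_mul, Nat.cast_pow, ZMod.natCast_zmod_val,
      mul_right_inj' (sub_ne_zero.2 hxy)] at heq
    exact Nat.eq_of_mul_eq_mul_left hn0 (pow_injOn_Iio_orderOf (hlt hi) (hlt hi') heq)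
  obtain ⟨i, -, hi⟩ := exists_apply_add_eq (natCast_ne_zero_of_orderOf_card hq)
    (hj (x - y).val) hinj y (Finset.mem_range.2 hm0)
  refine ⟨i, ?_⟩
  simp only [mul_zero, pow_zero, mul_one, Nat.cast_mul,
    Nat.cast_pow, ZMod.natCast_zmod_val, add_sub_cancel] at hi
  exact sub_eq_iff_eq_add'.2 hi

theorem exists_sub_pow_eq (hq : orderOf (Fintype.card F : ZMod p) = p - 1)
    {H : Subgroup (Perm (ZMod p))} (hH : shift p ∈ H)
    {A : Subalgebra F (Module.End F (sumZero F (ZMod p)))} [IsDomain A]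
    (hA : IsConjStable ((sumZeroRep F (ZMod p)).comp H.subtype) A) (hbot : A ≠ ⊥) :
    ∃ m, 0 < m ∧ 2 * m < p ∧ ∀ s ∈ H, ∃ c : ZMod p,
      ∀ x y, (s x - s y) ^ m = c * (x - y) ^ m := by
  obtain ⟨n, hn1, ⟨m, hm⟩, hsub⟩ := exists_sub_eq_mul_pow hq hH hA hbot
  have hpos : 0 < p - 1 := Nat.sub_pos_of_lt (Fact.out : p.Prime).one_lt
  have hn0 : n ≠ 0 := fun h0 => hpos.ne' (by rw [hm, h0, zero_mul])
  have hm0 : m ≠ 0 := fun h0 => hpos.ne' (by rw [hm, h0, mul_zero])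
  have h2m : 2 * m ≤ p - 1 := hm ▸ Nat.mul_le_mul_right m (by omega)
  refine ⟨m, Nat.pos_of_ne_zero hm0, by omega, fun s hs => ?_⟩
  obtain ⟨j, hj⟩ := hsub s hs
  refine ⟨(Fintype.card F ^ j) ^ m, fun x y => ?_⟩
  obtain ⟨i, hi⟩ := hj x y
  have hroot : ((Fintype.card F : ZMod p) ^ (n * i)) ^ m = 1 := by
    rw [← pow_mul, mul_right_comm, ← hm, pow_mul, ← hq, pow_orderOf_eq_one, one_pow]
  rw [hi, mul_pow, mul_pow, hroot, one_mul, mul_comm]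

end Shift

section Affine

open Polynomial

theorem sum_eval_eq_neg_coeff {K : Type*} [Field K] [Fintype K] {Q : K[X]}
    (hQ : Q.natDegree ≤ Fintype.card K - 1) :
    ∑ x, Q.eval x = -Q.coeff (Fintype.card K - 1) := by
  classical
  have hpow (i : ℕ) (hi : i ∈ Finset.range (Fintype.card K - 1)) :
      ∑ x : K, Q.coeff i * x ^ i = 0 := by
    rw [← Finset.mul_sum, FiniteField.sum_pow_lt_card_sub_one K i (Finset.mem_range.1 hi), mul_zero]
  have hpow' : ∑ x : K, x ^ (Fintype.card K - 1) = -1 := by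
    have hpos : Fintype.card K - 1 ≠ 0 := (Nat.sub_pos_of_lt Fintype.one_lt_card).ne'
    rw [← Finset.sum_erase (a := 0) _ (zero_pow hpos), Finset.sum_congr rfl fun x hx =>
      FiniteField.pow_card_sub_one_eq_one x (Finset.ne_of_mem_erase hx), Finset.sum_const,
      Finset.card_erase_of_mem (Finset.mem_univ _), Finset.card_univ, nsmul_one,
      Nat.cast_pred Fintype.card_pos, Nat.cast_card_eq_zero, zero_sub]
  simp only [eval_eq_sum_range' (Nat.lt_succ_of_le hQ)]
  rw [Finset.sum_comm, Finset.sum_range_succ, Finset.sum_eq_zero hpow, zero_add, ← Finset.mul_sum,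
    hpow', mul_neg_one]

variable {p : ℕ} [Fact p.Prime] {s : ZMod p → ZMod p} {m : ℕ} {c : ZMod p}

-- These sums are, up to binomial coefficients, the coefficients of the polynomial
-- `∑ x, x ^ i * (t + s x) ^ m` in `t`, which vanishes everywhere by the hypothesis on `s`.
theorem sum_pow_mul_apply_pow_eq_zero (hs : Function.Surjective s)
    (hsub : ∀ x y, (s x - s y) ^ m = c * (x - y) ^ m) {i k : ℕ} (hi : i + m < p - 1) (hk : k ≤ m) :
    ∑ x, x ^ i * s x ^ k = 0 := by
  let T : (ZMod p)[X] := ∑ x, C (x ^ i) * (X + C (s x)) ^ m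
  have hdeg : T.natDegree < Fintype.card (ZMod p) := by
    rw [ZMod.card]
    refine (natDegree_sum_le_of_forall_le (n := m) _ _ fun x _ => ?_).trans_lt (by omega)
    exact (natDegree_C_mul_le _ _).trans (natDegree_pow_X_add_C m (s x)).le
  have heval (t : ZMod p) : T.eval t = 0 := by
    obtain ⟨y, hy⟩ := hs (-t)
    let Q : (ZMod p)[X] := C c * (X ^ i * (X - C y) ^ m)
    have hQ : Q.natDegree < p - 1 := by
      refine (natDegree_C_mul_le _ _).trans_lt (natDegree_mul_le.trans_lt ?_)
      rwa [natDegree_X_pow, natDegree_pow, natDegree_X_sub_C, mul_one]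
    calc T.eval t = ∑ x, Q.eval x := by
          simp only [T, Q, eval_finsetSum, eval_mul, eval_C, eval_pow, eval_add, eval_sub, eval_X]
          refine Finset.sum_congr rfl fun x _ => ?_
          rw [mul_left_comm, ← hsub, hy, sub_neg_eq_add, add_comm t]
      _ = -Q.coeff (p - 1) := by
          have := sum_eval_eq_neg_coeff (Q := Q) (by rw [ZMod.card]; exact hQ.le)
          rwa [ZMod.card] at this
      _ = 0 := by rw [coeff_eq_zero_of_natDegree_lt hQ, neg_zero]
  have hT : T = 0 := eq_zero_of_natDegree_lt_card_of_eval_eq_zero T Function.injective_id heval hdeg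
  have hcoeff : T.coeff (m - k) = (∑ x, x ^ i * s x ^ k) * m.choose k := by
    simp only [T, finsetSum_coeff, coeff_C_mul, coeff_X_add_C_pow, Nat.sub_sub_self hk,
      Nat.choose_symm hk, Finset.sum_mul, mul_assoc]
  have hchoose : (m.choose k : ZMod p) ≠ 0 := fun h0 =>
    (Fact.out : p.Prime).coprime_iff_not_dvd.1
      (Nat.Prime.coprime_choose_of_lt Fact.out (by omega) hk) ((ZMod.natCast_eq_zero_iff _ _).1 h0)
  rw [hT, coeff_zero, eq_comm] at hcoeff
  exact (mul_eq_zero.1 hcoeff).resolve_right hchoose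

theorem exists_eq_mul_add_of_sub_pow_eq (hs : Function.Surjective s) (hm : 0 < m) (hmp : 2 * m < p)
    (hsub : ∀ x y, (s x - s y) ^ m = c * (x - y) ^ m) : ∃ a b, ∀ x, s x = a * x + b := by
  let S := Lagrange.interpolate Finset.univ id s
  have hS (x : ZMod p) : S.eval x = s x :=
    Lagrange.eval_interpolate_at_node s Function.injective_id.injOn (Finset.mem_univ x)
  have hdeg : S.natDegree ≤ p - 1 := by
    have := Lagrange.degree_interpolate_le s (s := Finset.univ) Function.injective_id.injOn
    rw [Finset.card_univ, ZMod.card] at this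
    exact natDegree_le_of_degree_le this
  suffices h1 : S.natDegree ≤ 1 from
    ⟨S.coeff 1, S.coeff 0, fun x => by rw [← hS, eq_X_add_C_of_natDegree_le_one h1]; simp⟩
  by_contra! hd
  let k := m / S.natDegree + 1
  have hkm : k ≤ m := Nat.div_lt_self hm hd
  have hmk : m < S.natDegree * k := Nat.lt_mul_div_succ m (by omega)
  have hkp : S.natDegree * k ≤ p - 1 := by
    rcases lt_or_ge m S.natDegree with hlt | hle
    · simpa only [k, Nat.div_eq_of_lt hlt, zero_add, mul_one] using hdeg
    · have := Nat.mul_div_le m S.natDegree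
      rw [Nat.mul_succ]
      omega
  let Q := X ^ (p - 1 - S.natDegree * k) * S ^ k
  have hQ : Q.coeff (p - 1) = S.leadingCoeff ^ k := by
    rw [coeff_X_pow_mul', if_pos (Nat.sub_le _ _), Nat.sub_sub_self hkp, ← leadingCoeff_pow,
      leadingCoeff, natDegree_pow, mul_comm]
  have hQdeg : Q.natDegree ≤ p - 1 := by
    refine natDegree_mul_le.trans ?_
    rw [natDegree_X_pow, natDegree_pow, mul_comm k, Nat.sub_add_cancel hkp]
  have hsum := sum_pow_mul_apply_pow_eq_zero hs hsub (i := p - 1 - S.natDegree * k)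
    (by omega) hkm
  have hsum' := sum_eval_eq_neg_coeff (Q := Q) (by rwa [ZMod.card])
  simp only [ZMod.card, hQ, Q, eval_mul, eval_pow, eval_X, hS, hsum] at hsum'
  have hS0 : S ≠ 0 := ne_zero_of_natDegree_gt hd
  exact pow_ne_zero k (leadingCoeff_ne_zero.2 hS0) (neg_eq_zero.1 hsum'.symm)

end Affine

theorem natCard_le_of_forall_exists_eq_mul_add {K : Type*} [Field K] [Fintype K]
    {H : Subgroup (Perm K)} (h : ∀ s ∈ H, ∃ a b, ∀ x, s x = a * x + b) :
    Nat.card H ≤ Fintype.card K * (Fintype.card K - 1) := by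
  classical
  choose a b hab using fun s : H => h s s.2
  have ha (s : H) : a s ≠ 0 := fun h0 =>
    zero_ne_one (s.1.injective (by rw [hab, hab, h0, zero_mul, zero_mul]))
  let f (s : H) : K × Kˣ := (b s, Units.mk0 (a s) (ha s))
  have hf : Function.Injective f := fun s t hst => by
    obtain ⟨hb, ha⟩ := Prod.mk_inj.1 hst
    exact Subtype.ext <| Equiv.ext fun x => by rw [hab, hab, hb, (Units.mk0_inj _ _).1 ha]
  calc Nat.card H ≤ Nat.card (K × Kˣ) := Nat.card_le_card_of_injective f hf
    _ = Fintype.card K * (Fintype.card K - 1) := by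
        rw [Nat.card_prod, Nat.card_eq_fintype_card, Nat.card_eq_fintype_card,
          Fintype.card_units]

section PrimeDegree

variable {p : ℕ} [Fact p.Prime] {F : Type*} [Field F] [Fintype F]

theorem isVerySimple_sumZeroRep_of_shift_mem (hq : orderOf (Fintype.card F : ZMod p) = p - 1)
    {H : Subgroup (Perm (ZMod p))} (hH : shift p ∈ H) (hcard : p * (p - 1) < Nat.card H) :
    IsVerySimple ((sumZeroRep F (ZMod p)).comp H.subtype) := by
  have hdim : Module.finrank F (sumZero F (ZMod p)) = p - 1 := by rw [finrank_sumZero, ZMod.card]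
  have : Nontrivial (sumZero F (ZMod p)) := Module.nontrivial_of_finrank_pos
    (hdim ▸ Nat.sub_pos_of_lt (Fact.out : p.Prime).one_lt)
  have hpow : (⟨shift p, hH⟩ : H) ^ p = 1 := Subtype.ext shift_pow_self
  refine isVerySimple_of_forall_isDomain (hq.trans hdim.symm) hpow
    (isIrreducibleEnd_sumZeroRep_shift hq) fun A hA _ => ?_
  by_contra hbot
  obtain ⟨m, hm, hmp, hsub⟩ := exists_sub_pow_eq hq hH hA hbot
  refine hcard.not_ge ((natCard_le_of_forall_exists_eq_mul_add fun s hs => ?_).trans_eq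
    (by rw [ZMod.card]))
  obtain ⟨c, hc⟩ := hsub s hs
  exact exists_eq_mul_add_of_sub_pow_eq s.surjective hm hmp hc

end PrimeDegree

theorem IsVerySimple.of_linearEquiv {F G G' V V' : Type*} [Field F] [Group G] [Group G']
    [AddCommGroup V] [Module F V] [AddCommGroup V'] [Module F V'] {ρ : Representation F G V}
    {ρ' : Representation F G' V'} (hρ' : IsVerySimple ρ') (φ : G' →* G) (e : V' ≃ₗ[F] V)
    (he : ∀ s v, e (ρ' s v) = ρ (φ s) (e v)) : IsVerySimple ρ := by
  intro R hR
  let ε : Module.End F V' →ₐ[F] Module.End F V := e.conjAlgEquiv F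
  have hε : Function.Surjective ε := (e.conjAlgEquiv F).surjective
  have hconj (s : G') : ε (ρ' s) = ρ (φ s) := by
    ext v
    exact (he s _).trans (congrArg _ (e.apply_symm_apply v))
  have hmap : (R.comap ε).map ε = R := Subalgebra.map_comap_eq_self_of_surjective hε R
  have hstab (s : G') (r : Module.End F V') (hr : r ∈ R.comap ε) :
      ρ' s * r * ρ' s⁻¹ ∈ R.comap ε := by
    rw [Subalgebra.mem_comap] at hr ⊢
    rw [map_mul, map_mul, hconj, hconj, map_inv]
    exact hR (φ s) _ hr
  rcases hρ' (R.comap ε) hstab with h | h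
  · exact .inl (by rw [← hmap, h, Algebra.map_bot])
  · exact .inr (by rw [← hmap, h, Algebra.map_top, (AlgHom.range_eq_top ε).2 hε])

section ExtendByZero

variable {F : Type*} [Field F] {A B : Type*} [Fintype A] [Fintype B]

variable (F) in
/-- Extension by zero, along an embedding `ι : A ↪ B`, of functions with sum zero. -/
noncomputable def sumZeroExtend (ι : A ↪ B) : sumZero F A →ₗ[F] sumZero F B :=
  (Function.ExtendByZero.linearMap F ι).restrict fun h hh => by
    rw [mem_sumZero, ← (mem_sumZero F A h).1 hh]
    exact (Fintype.sum_of_injective ι ι.injective h (Function.extend ι h 0)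
      (fun _ hb => Function.extend_apply' _ _ _ hb)
      fun a => (ι.injective.extend_apply h 0 a).symm).symm

variable {ι : A ↪ B}

theorem sumZeroExtend_apply (h : sumZero F A) (a : A) : (sumZeroExtend F ι h).1 (ι a) = h.1 a :=
  ι.injective.extend_apply _ _ a

theorem sumZeroExtend_apply_of_notMem (h : sumZero F A) {b : B} (hb : b ∉ Set.range ι) :
    (sumZeroExtend F ι h).1 b = 0 :=
  Function.extend_apply' _ _ _ hb

theorem sumZeroExtend_injective : Function.Injective (sumZeroExtend F ι) := fun h k hk => by
  ext a
  rw [← sumZeroExtend_apply (ι := ι), hk, sumZeroExtend_apply]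

theorem sumZeroExtend_sumZeroRep (s : Perm A) (h : sumZero F A) :
    sumZeroExtend F ι (sumZeroRep F A s h) =
      sumZeroRep F B (Perm.viaEmbeddingHom ι s) (sumZeroExtend F ι h) := by
  refine Subtype.ext (funext fun b => ?_)
  change _ = (sumZeroExtend F ι h).1 ((Perm.viaEmbeddingHom ι s)⁻¹ b)
  rw [← map_inv, Perm.viaEmbeddingHom_apply]
  by_cases hb : b ∈ Set.range ι
  · obtain ⟨a, rfl⟩ := hb
    rw [Perm.viaEmbedding_apply, sumZeroExtend_apply, sumZeroExtend_apply]
    rfl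
  · rw [Perm.viaEmbedding_apply_of_notMem _ _ _ hb, sumZeroExtend_apply_of_notMem _ hb,
      sumZeroExtend_apply_of_notMem _ hb]

theorem sumZeroExtend_surjective (hι : Function.Surjective ι) :
    Function.Surjective (sumZeroExtend F ι) := fun v => by
  have hv : v.1 ∘ ι ∈ sumZero F A :=
    (Function.Bijective.sum_comp ⟨ι.injective, hι⟩ v.1).trans v.2
  refine ⟨⟨_, hv⟩, Subtype.ext (funext <| hι.forall.2 fun a => ?_)⟩
  exact sumZeroExtend_apply _ a

theorem mkQ_sumZeroExtend_injective (hι : ¬ Function.Surjective ι) :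
    Function.Injective ((constLine F B).mkQ ∘ₗ sumZeroExtend F ι) := by
  rw [← LinearMap.ker_eq_bot, LinearMap.ker_eq_bot']
  intro v hv
  rw [LinearMap.comp_apply, Submodule.mkQ_apply, Submodule.Quotient.mk_eq_zero] at hv
  obtain ⟨c, hc⟩ := Submodule.mem_span_singleton.1 (Submodule.mem_comap.1 hv)
  obtain ⟨b, hb⟩ := not_forall.1 hι
  have hc0 : c = 0 := by
    have := congrFun hc b
    rwa [Submodule.subtype_apply, sumZeroExtend_apply_of_notMem v hb, Pi.smul_apply, Pi.one_apply,
      smul_eq_mul, mul_one] at this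
  rw [hc0, zero_smul] at hc
  exact sumZeroExtend_injective (Subtype.ext (hc.symm.trans (by rw [map_zero]; rfl)))

theorem mkQ_sumZeroExtend_surjective {b₀ : B} (hb₀ : Set.range ι = {b₀}ᶜ)
    (hB : (Fintype.card B : F) = 0) :
    Function.Surjective ((constLine F B).mkQ ∘ₗ sumZeroExtend F ι) := by
  intro q
  obtain ⟨v, rfl⟩ := Submodule.mkQ_surjective _ q
  have hnotMem {b : B} (hb : b ∉ Set.range ι) : b = b₀ := by simpa [hb₀] using hb
  have hw : (fun a => v.1 (ι a) - v.1 b₀) ∈ sumZero F A := by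
    calc ∑ a, (v.1 (ι a) - v.1 b₀) = ∑ b, (v.1 b - v.1 b₀) :=
          Fintype.sum_of_injective ι ι.injective _ _
            (fun b hb => by rw [hnotMem hb, sub_self]) fun a => rfl
      _ = 0 := by
        rw [Finset.sum_sub_distrib, (mem_sumZero F B _).1 v.2, Finset.sum_const,
          Finset.card_univ, nsmul_eq_mul, hB, zero_mul, sub_zero]
  refine ⟨⟨_, hw⟩, ?_⟩
  rw [LinearMap.comp_apply, Submodule.mkQ_apply, Submodule.mkQ_apply, Submodule.Quotient.eq]
  refine Submodule.mem_comap.2 (Submodule.mem_span_singleton.2 ⟨-v.1 b₀, funext fun b => ?_⟩)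
  change -v.1 b₀ * 1 = (sumZeroExtend F ι _).1 b - v.1 b
  by_cases hb : b ∈ Set.range ι
  · obtain ⟨a, rfl⟩ := hb
    rw [sumZeroExtend_apply]
    ring
  · rw [sumZeroExtend_apply_of_notMem _ hb, hnotMem hb]
    ring

variable {G : Subgroup (Perm B)}

theorem isVerySimple_sumZeroRep_of_comap (hι : Function.Surjective ι)
    (h : IsVerySimple ((sumZeroRep F A).comp (G.comap (Perm.viaEmbeddingHom ι)).subtype)) :
    IsVerySimple ((sumZeroRep F B).comp G.subtype) :=
  h.of_linearEquiv ((Perm.viaEmbeddingHom ι).subgroupComap G)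
    (.ofBijective (sumZeroExtend F ι) ⟨sumZeroExtend_injective, sumZeroExtend_surjective hι⟩)
    fun s => sumZeroExtend_sumZeroRep s.1

theorem isVerySimple_heartRep_of_comap (hAB : Fintype.card B = Fintype.card A + 1)
    (hB : (Fintype.card B : F) = 0)
    (h : IsVerySimple ((sumZeroRep F A).comp (G.comap (Perm.viaEmbeddingHom ι)).subtype)) :
    IsVerySimple ((heartRep F B).comp G.subtype) := by
  obtain ⟨b₀, hb₀⟩ : ∃ b₀, (Set.range ι)ᶜ = {b₀} := by
    rw [← Set.ncard_eq_one, Set.ncard_compl, Set.ncard_range_of_injective ι.injective,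
      Nat.card_eq_fintype_card, Nat.card_eq_fintype_card, hAB, Nat.add_sub_cancel_left]
  rw [compl_eq_comm] at hb₀
  have hι : ¬ Function.Surjective ι := fun hsurj =>
    (hb₀ ▸ hsurj b₀ : b₀ ∈ ({b₀}ᶜ : Set B)) rfl
  exact h.of_linearEquiv ((Perm.viaEmbeddingHom ι).subgroupComap G)
    (.ofBijective _ ⟨mkQ_sumZeroExtend_injective hι, mkQ_sumZeroExtend_surjective hb₀.symm hB⟩)
    fun s v => congrArg (constLine F B).mkQ (sumZeroExtend_sumZeroRep s.1 v)

end ExtendByZero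

theorem natCard_mul_natCard_le_natCard_comap_mul {N N' : Type*} [Group N] [Group N'] [Finite N']
    (f : N →* N') (G : Subgroup N') :
    Nat.card G * Nat.card N ≤ Nat.card (G.comap f) * Nat.card N' := by
  have hle : G.relIndex f.range ≤ G.index := by
    rw [← G.relIndex_top_right]
    exact Subgroup.relIndex_le_of_le_right le_top Subgroup.FiniteIndex.index_ne_zero
  calc Nat.card G * Nat.card N = Nat.card (G.comap f) * (G.relIndex f.range * Nat.card G) := by
        rw [← (G.comap f).card_mul_index, G.index_comap]
        ring
    _ ≤ Nat.card (G.comap f) * (G.index * Nat.card G) := by gcongr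
    _ = Nat.card (G.comap f) * Nat.card N' := by rw [G.index_mul_card]

theorem viaEmbedding_trans_perm {A B : Type*} (s : Perm A) (ι : A ↪ B) (t : Perm B) :
    s.viaEmbedding (ι.trans t.toEmbedding) = t * s.viaEmbedding ι * t⁻¹ := by
  rw [eq_mul_inv_iff_mul_eq]
  ext b
  rw [Perm.mul_apply, Perm.mul_apply]
  by_cases hb : b ∈ Set.range ι
  · obtain ⟨a, rfl⟩ := hb
    rw [Perm.viaEmbedding_apply]
    exact Perm.viaEmbedding_apply s (ι.trans t.toEmbedding) a
  · rw [Perm.viaEmbedding_apply_of_notMem _ _ _ hb, Perm.viaEmbedding_apply_of_notMem]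
    rintro ⟨a, ha⟩
    exact hb ⟨a, t.injective ha⟩

theorem exists_viaEmbedding_eq {A B : Type*} [Fintype A] [Fintype B] {p : ℕ} (hp : p.Prime)
    (hAB : Fintype.card A ≤ Fintype.card B) (hB : Fintype.card B < 2 * p) {s : Perm A}
    (hs : orderOf s = p) {g : Perm B} (hg : orderOf g = p) :
    ∃ ι : A ↪ B, s.viaEmbedding ι = g := by
  classical
  obtain ⟨κ⟩ := Function.Embedding.nonempty_of_card_le hAB
  have hκ : orderOf (s.viaEmbedding κ) = p :=
    (orderOf_injective _ (Perm.viaEmbeddingHom_injective κ) s).trans hs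
  have hcycle {t : Perm B} (ht : orderOf t = p) : t.IsCycle :=
    Perm.isCycle_of_prime_order' (ht ▸ hp) (ht ▸ hB)
  have hconj : IsConj (s.viaEmbedding κ) g := by
    rw [(hcycle hκ).isConj_iff (hcycle hg), ← (hcycle hκ).orderOf, ← (hcycle hg).orderOf, hκ, hg]
  obtain ⟨t, ht⟩ := isConj_iff.1 hconj
  exact ⟨κ.trans t.toEmbedding, (viaEmbedding_trans_perm s κ t).trans ht⟩

section CyclicShift

variable {p : ℕ} [Fact p.Prime]

theorem orderOf_shift : orderOf (shift p) = p := by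
  refine orderOf_eq_prime shift_pow_self fun h => ?_
  have := DFunLike.congr_fun h (0 : ZMod p)
  exact one_ne_zero ((zero_add (1 : ZMod p)).symm.trans this)

variable {B : Type*} [Fintype B] {G : Subgroup (Perm B)}

theorem exists_shift_mem_comap (hdvd : p ∣ Nat.card G) (hB : p ≤ Fintype.card B)
    (hB' : Fintype.card B < 2 * p) :
    ∃ ι : ZMod p ↪ B, shift p ∈ G.comap (Perm.viaEmbeddingHom ι) := by
  obtain ⟨g, hg⟩ := exists_prime_orderOf_dvd_card' p hdvd
  obtain ⟨ι, hι⟩ := exists_viaEmbedding_eq Fact.out ((ZMod.card p).trans_le hB) hB' orderOf_shift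
    ((Subgroup.orderOf_coe g).trans hg)
  refine ⟨ι, ?_⟩
  rw [Subgroup.mem_comap, Perm.viaEmbeddingHom_apply, hι]
  exact g.2

theorem natCard_mul_factorial_le (G : Subgroup (Perm B)) (ι : ZMod p ↪ B) :
    Nat.card G * p.factorial ≤
      Nat.card (G.comap (Perm.viaEmbeddingHom ι)) * (Fintype.card B).factorial := by
  have := natCard_mul_natCard_le_natCard_comap_mul (Perm.viaEmbeddingHom ι) G
  rwa [Nat.card_perm, Nat.card_perm, Nat.card_zmod, Nat.card_eq_fintype_card (α := B)] at this

variable {F : Type*} [Field F] [Fintype F]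

theorem isVerySimple_sumZeroRep_of_lt_natCard (hq : orderOf (Fintype.card F : ZMod p) = p - 1)
    (hdvd : p ∣ Nat.card G) (hB : Fintype.card B = p) (hcard : p * (p - 1) < Nat.card G) :
    IsVerySimple ((sumZeroRep F B).comp G.subtype) := by
  have hp0 : 0 < p := (Fact.out : p.Prime).pos
  obtain ⟨ι, hι⟩ := exists_shift_mem_comap hdvd hB.ge (by omega)
  have hsurj : Function.Surjective ι :=
    ((Fintype.bijective_iff_injective_and_card ι).2 ⟨ι.injective, by rw [ZMod.card, hB]⟩).2
  refine isVerySimple_sumZeroRep_of_comap hsurj (isVerySimple_sumZeroRep_of_shift_mem hq hι ?_)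
  have := natCard_mul_factorial_le G ι
  rw [hB] at this
  exact hcard.trans_le (Nat.le_of_mul_le_mul_right this p.factorial_pos)

theorem isVerySimple_heartRep_of_lt_natCard (hq : orderOf (Fintype.card F : ZMod p) = p - 1)
    (hp : 2 < p) (hpF : (p : F) + 1 = 0) (hdvd : p ∣ Nat.card G) (hB : Fintype.card B = p + 1)
    (hcard : (p + 1) * (p * (p - 1)) < Nat.card G) :
    IsVerySimple ((heartRep F B).comp G.subtype) := by
  obtain ⟨ι, hι⟩ := exists_shift_mem_comap hdvd (hB ▸ p.le_succ) (by omega)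
  refine isVerySimple_heartRep_of_comap (by rw [hB, ZMod.card]) (by rw [hB, Nat.cast_succ, hpF])
    (isVerySimple_sumZeroRep_of_shift_mem hq hι ?_)
  have := natCard_mul_factorial_le G ι
  rw [hB, p.factorial_succ, ← mul_assoc] at this
  refine Nat.lt_of_mul_lt_mul_left (a := p + 1) (hcard.trans_le ?_)
  rw [mul_comm (p + 1)]
  exact Nat.le_of_mul_le_mul_right this p.factorial_pos

end CyclicShift

section Orders

theorem sq_dvd_natCard_of_commute {G : Type*} [Group G] {M : Subgroup G} {p : ℕ} [Fact p.Prime]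
    {x y : G} (hxM : x ∈ M) (hyM : y ∈ M) (hx : orderOf x = p) (hy : orderOf y = p)
    (hxy : Commute x y) (hyx : y ∉ Subgroup.zpowers x) : p ^ 2 ∣ Nat.card M := by
  have hdisj : Disjoint (Subgroup.zpowers x) (Subgroup.zpowers y) := by
    have : Fact (Nat.card (Subgroup.zpowers y)).Prime := by rwa [Nat.card_zpowers, hy]
    rw [← Subgroup.subgroupOf_eq_bot]
    refine (Subgroup.eq_bot_or_eq_top_of_prime_card _).resolve_right fun htop => hyx ?_
    exact Subgroup.subgroupOf_eq_top.1 htop (Subgroup.mem_zpowers y)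
  have hcomm : ∀ (m : Subgroup.zpowers x) (n : Subgroup.zpowers y),
      Commute ((Subgroup.zpowers x).subtype m) ((Subgroup.zpowers y).subtype n) := by
    rintro ⟨_, i, rfl⟩ ⟨_, j, rfl⟩
    exact hxy.zpow_zpow i j
  let f := MonoidHom.noncommCoprod _ _ hcomm
  have hf : Function.Injective f := by
    rw [MonoidHom.noncommCoprod_injective]
    refine ⟨Subtype.val_injective, Subtype.val_injective, ?_⟩
    rwa [Subgroup.range_subtype, Subgroup.range_subtype]
  have hle : f.range ≤ M := by
    rw [MonoidHom.noncommCoprod_range, Subgroup.range_subtype, Subgroup.range_subtype]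
    exact sup_le (Subgroup.zpowers_le.2 hxM) (Subgroup.zpowers_le.2 hyM)
  calc p ^ 2 = Nat.card f.range := by
        rw [Nat.card_congr (f.ofInjective hf).symm.toEquiv, Nat.card_prod, Nat.card_zpowers,
          Nat.card_zpowers, hx, hy, sq]
    _ ∣ Nat.card M := Subgroup.card_dvd_of_le hle

set_option maxRecDepth 100000 in
theorem dvd_natCard_mathieuM11 : 1980 ∣ Nat.card MathieuM11 := by
  have := Fact.mk Nat.prime_three
  have := Fact.mk Nat.prime_five
  have := Fact.mk Nat.prime_eleven
  let a : Perm (Fin 11) := List.formPerm [0, 1, 2, 3, 4, 5, 6, 7, 8, 9, 10]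
  let b : Perm (Fin 11) := List.formPerm [2, 6, 10, 7] * List.formPerm [3, 9, 4, 5]
  let x := a ^ 10 * b ^ 2 * a ^ 2
  let y := b * a * b
  have ha : a ∈ MathieuM11 := Subgroup.subset_closure (.inl rfl)
  have hb : b ∈ MathieuM11 := Subgroup.subset_closure (.inr rfl)
  have hx : orderOf x = 3 := orderOf_eq_prime (by decide) (by decide)
  have hy : orderOf y = 3 := orderOf_eq_prime (by decide) (by decide)
  have h4 : orderOf b = 2 ^ (1 + 1) := orderOf_eq_prime_pow (by decide) (by decide)
  have h5 : orderOf (a ^ 3 * b) = 5 := orderOf_eq_prime (by decide) (by decide)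
  have h11 : orderOf a = 11 := orderOf_eq_prime (by decide) (by decide)
  have hyx : y ∉ Subgroup.zpowers x := by
    rw [mem_zpowers_iff_mem_range_orderOf, hx]
    decide
  have dvd4 := MathieuM11.orderOf_dvd_natCard hb
  have dvd5 := MathieuM11.orderOf_dvd_natCard (mul_mem (pow_mem ha 3) hb)
  have dvd11 := MathieuM11.orderOf_dvd_natCard ha
  have dvd9 : 3 ^ 2 ∣ Nat.card MathieuM11 := sq_dvd_natCard_of_commute
    (mul_mem (mul_mem (pow_mem ha 10) (pow_mem hb 2)) (pow_mem ha 2)) (mul_mem (mul_mem hb ha) hb)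
    hx hy (by decide : x * y = y * x) hyx
  rw [h4] at dvd4
  rw [h5] at dvd5
  rw [h11] at dvd11
  omega

set_option maxRecDepth 100000 in
theorem natCard_mathieuM11_dvd_natCard_mathieuM12 : Nat.card MathieuM11 ∣ Nat.card MathieuM12 := by
  let f : Perm (Fin 11) →* Perm (Fin 12) := Perm.extendDomainHom Fin.castSuccEmb.toEquivRange
  have hf : Function.Injective f := Perm.extendDomainHom_injective _
  have hle : MathieuM11.map f ≤ MathieuM12 := by
    rw [MathieuM11, MonoidHom.map_closure, Subgroup.closure_le, Set.image_pair, Set.pair_subset_iff]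
    constructor
    · exact Subgroup.subset_closure (.inl (by decide))
    · exact Subgroup.subset_closure (.inr (.inl (by decide)))
  rw [← Subgroup.card_map_of_injective hf]
  exact Subgroup.card_dvd_of_le hle

end Orders

section SpecialLinear

open Matrix

theorem dvd_natCard_projectiveSpecialLinearGroup {ι R : Type*} [Fintype ι] [DecidableEq ι]
    [CommRing R] {p : ℕ} (hp : p.Prime) {A C : SpecialLinearGroup ι R} (hA : A ^ p = 1)
    (hAC : C * A ≠ A * C) : p ∣ Nat.card (ProjectiveSpecialLinearGroup ι R) := by
  have := Fact.mk hp
  have horder : orderOf (A : ProjectiveSpecialLinearGroup ι R) = p := by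
    refine orderOf_eq_prime ?_ fun h => ?_
    · rw [← QuotientGroup.mk_pow, hA, QuotientGroup.mk_one]
    · rw [QuotientGroup.eq_one_iff] at h
      exact hAC (Subgroup.mem_center_iff.1 h C)
  exact (congrArg (· ∣ _) horder).mp (orderOf_dvd_natCard _)

theorem dvd_natCard_projectiveSpecialLinearGroup_eleven :
    165 ∣ Nat.card (ProjectiveSpecialLinearGroup (Fin 2) (ZMod 11)) := by
  let C : SpecialLinearGroup (Fin 2) (ZMod 11) := ⟨!![1, 0; 1, 1], by decide⟩
  have h3 := dvd_natCard_projectiveSpecialLinearGroup Nat.prime_three (C := C)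
    (A := ⟨!![0, 10; 1, 10], by decide⟩) (by decide) (by decide)
  have h5 := dvd_natCard_projectiveSpecialLinearGroup Nat.prime_five (C := C)
    (A := ⟨!![3, 0; 0, 4], by decide⟩) (by decide) (by decide)
  have h11 := dvd_natCard_projectiveSpecialLinearGroup Nat.prime_eleven (C := C)
    (A := ⟨!![1, 1; 0, 1], by decide⟩) (by decide) (by decide)
  omega

end SpecialLinear

theorem orderOf_two_zmod_eleven : orderOf (2 : ZMod 11) = 11 - 1 :=
  (orderOf_eq_iff (by decide)).2 ⟨by decide, by decide⟩

theorem theorem6p10_general {p : ℕ} [Fact p.Prime] {B : Type*} [Fintype B]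
    {G : Subgroup (Perm B)} (h2 : orderOf (2 : ZMod p) = p - 1) (hdvd : p ∣ Nat.card G)
    (h : (Fintype.card B = p ∧ p * (p - 1) < Nat.card G) ∨
      (Fintype.card B = p + 1 ∧ (p + 1) * (p * (p - 1)) < Nat.card G)) :
    QIsVerySimple G := by
  have hq : orderOf (Fintype.card (ZMod 2) : ZMod p) = p - 1 := by rwa [ZMod.card]
  have hodd : Odd p := by
    rw [← Nat.not_even_iff_odd, ← ZMod.natCast_eq_zero_iff_even]
    exact natCast_ne_zero_of_orderOf_card hq
  rcases h with ⟨hB, hcard⟩ | ⟨hB, hcard⟩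
  · rw [QIsVerySimple, if_neg (hB ▸ Nat.not_even_iff_odd.2 hodd)]
    exact isVerySimple_sumZeroRep_of_lt_natCard hq hdvd hB hcard
  · rw [QIsVerySimple, if_pos (hB ▸ hodd.add_one)]
    refine isVerySimple_heartRep_of_lt_natCard hq ?_ ?_ hdvd hB hcard
    · exact (Fact.out : p.Prime).two_le.lt_of_ne' fun h => absurd (h ▸ hodd) (by decide)
    · exact_mod_cast ZMod.natCast_eq_zero_iff_even.2 hodd.add_one

theorem theorem6p10 {B : Type*} [Fintype B] (G : Subgroup (Equiv.Perm B))
    (h : (Fintype.card B = 11 ∧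
            (Nonempty (G ≃* Matrix.ProjectiveSpecialLinearGroup (Fin 2) (ZMod 11)) ∨
              Nonempty (G ≃* MathieuM11))) ∨
         (Fintype.card B = 12 ∧
            (Nonempty (G ≃* MathieuM12) ∨
              (Nonempty (G ≃* MathieuM11) ∧ MulAction.IsPretransitive G B)))) :
    QIsVerySimple G := by
  have := Fact.mk Nat.prime_eleven
  rcases h with ⟨hB, h⟩ | ⟨hB, h⟩
  · have hdvd : 165 ∣ Nat.card G := by
      rcases h with ⟨⟨e⟩⟩ | ⟨⟨e⟩⟩ <;> rw [Nat.card_congr e.toEquiv]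
      · exact dvd_natCard_projectiveSpecialLinearGroup_eleven
      · exact .trans (by decide) dvd_natCard_mathieuM11
    have hlt : 11 * 10 < Nat.card G :=
      lt_of_lt_of_le (by decide) (Nat.le_of_dvd Nat.card_pos hdvd)
    exact theorem6p10_general orderOf_two_zmod_eleven (.trans (by decide) hdvd) (.inl ⟨hB, hlt⟩)
  · have hdvd : 1980 ∣ Nat.card G := by
      rcases h with ⟨⟨e⟩⟩ | ⟨⟨e⟩, -⟩ <;> rw [Nat.card_congr e.toEquiv]
      · exact dvd_natCard_mathieuM11.trans natCard_mathieuM11_dvd_natCard_mathieuM12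
      · exact dvd_natCard_mathieuM11
    have hlt : 12 * (11 * 10) < Nat.card G :=
      lt_of_lt_of_le (by decide) (Nat.le_of_dvd Nat.card_pos hdvd)
    exact theorem6p10_general orderOf_two_zmod_eleven (.trans (by decide) hdvd) (.inr ⟨hB, hlt⟩)
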